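/- For $n\ge 0$ the freehedron (Saneblidze's, or Hochschild, polytope) $\mathcal F^n$ is the following cellular subdivision of the cube $[0,2]^n$; its cells are called its faces. $\mathcal F^0$ is a point, and $\mathcal F^1$ is the interval $[0,2]$ with faces $\{0\},\{2\},[0,2]$ and with distinguished facet $X^1=\{2\}$. For $n\ge 2$, $\mathcal F^n$ is obtained from $\mathcal F^{n-1}\times[0,2]$ by splitting $X^{n-1}\times[0,2]$ into $X^{n-1}\times[0,1]$ and $X^{n-1}\times[1,2]$, and $X^n=X^{n-1}\times[1,2]$; that is, the faces of $\mathcal F^n$ are $G\times\{0\}$ and $G\times\{2\}$ for all faces $G$ of $\mathcal F^{n-1}$, together with $G\times[0,2]$ for the faces $G\not\subseteq X^{n-1}$, and $G\times[0,1]$, $G\times\{1\}$, $G\times[1,2]$ for the faces $G\subseteq X^{n-1}$. Direct every edge (one-dimensional face) of $\mathcal F^n$ from its coordinatewise smaller endpoint to its coordinatewise larger endpoint. A polytope $P$ with directed edges is called *directed* if the 1-skeleton of $P$, and that of each of its faces, is an oriented graph without directed cycles that has exactly one source and exactly one sink. For a face $F$ of a directed polytope $P$ write $\min F$ and $\max F$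 for the source and the sink of $F$. Vertices are ordered by the existence of a directed edge path in $P$, and for faces $F_1\le F_2$ means $\max F_1\le\min F_2$. A *face chain* in a face $F$ is a sequence $(F_1,\dots,F_k)$, $k\ge 1$, of faces of $P$ with $F_i\subseteq F$ for all $i$ and $F_1\le F_2\le\dots\le F_k$. It is *trivial* if $k=1$ and $F_1=F$. Its *excess* in $F$ is $$(\dim F-1)-\sum_{i=1}^k(\dim F_i-1).$$ $P$ is called *short* if, for every face $F$ of $P$, every nontrivial face chain in $F$ has strictly positive excess in $F$. **Theorem.** For every $n\ge 0$ the freehedron $\mathcal F^n$ is a directed polytope, the order on its vertices given by directed edge paths is the coordinatewise order, and $\mathcal F^n$ is short. -/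

import Mathlib

noncomputable section

/-- A polytope in `ℝⁿ` given by the set of its (nonempty, closed) faces, the polytope itself being
the largest of them, together with a relation that says how the edges are directed. -/
structure CellPolytope (n : ℕ) where
  /-- the faces of all dimensions -/
  faces : Set (Set (Fin n → ℝ))
  /-- an edge with endpoints `u` and `v` is directed from `u` to `v` if `dir u v` -/
  dir : (Fin n → ℝ) → (Fin n → ℝ) → Prop

/-- The dimension of a face: the dimension of its affine span. -/
def faceDim {n : ℕ} (F : Set (Fin n → ℝ)) : ℕ :=
  Module.finrank ℝ (vectorSpan ℝ F)

namespace CellPolytope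

variable {n : ℕ} (P : CellPolytope n)

/-- The vertices: points that are themselves faces. -/
def vertices : Set (Fin n → ℝ) :=
  {v | {v} ∈ P.faces}

/-- `u → v` is a directed edge of the 1-skeleton of `F`. -/
def ArrowIn (F : Set (Fin n → ℝ)) (u v : Fin n → ℝ) : Prop :=
  ∃ e ∈ P.faces, e ⊆ F ∧ faceDim e = 1 ∧
    u ∈ P.vertices ∧ v ∈ P.vertices ∧ u ∈ e ∧ v ∈ e ∧ u ≠ v ∧ P.dir u v

/-- `v` is a source of the directed 1-skeleton of `F`. -/
def IsSource (F : Set (Fin n → ℝ)) (v : Fin n → ℝ) : Prop :=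
  v ∈ P.vertices ∧ v ∈ F ∧ ∀ u, ¬ P.ArrowIn F u v

/-- `v` is a sink of the directed 1-skeleton of `F`. -/
def IsSink (F : Set (Fin n → ℝ)) (v : Fin n → ℝ) : Prop :=
  v ∈ P.vertices ∧ v ∈ F ∧ ∀ w, ¬ P.ArrowIn F v w

/-- A directed polytope: every edge has exactly two vertices and is directed from one of them to
the other (in one way only), and the directed 1-skeleton of every face has no directed cycles,
exactly one source and exactly one sink. -/
def IsDirected : Prop :=
  (∀ e ∈ P.faces, faceDim e = 1 →
    ∃ u v, u ≠ v ∧ {w | w ∈ P.vertices ∧ w ∈ e} = {u, v} ∧ P.dir u v ∧ ¬ P.dir v u) ∧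
  ∀ F ∈ P.faces,
    (∀ v, ¬ Relation.TransGen (P.ArrowIn F) v v) ∧
    (∃! v, P.IsSource F v) ∧
    (∃! v, P.IsSink F v)

/-- The order on vertices generated by the edge directions: there is a directed edge path in the
1-skeleton of `P` from `u` to `v`. -/
def VertexLE (u v : Fin n → ℝ) : Prop :=
  Relation.ReflTransGen (P.ArrowIn Set.univ) u v

/-- The relation `F ≤ G` on faces: `max F ≤ min G`, where `max F` is the sink of `F` and `min G` is
the source of `G`. -/
def FaceLE (F G : Set (Fin n → ℝ)) : Prop :=
  ∃ v w, P.IsSink F v ∧ P.IsSource G w ∧ P.VertexLE v w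

/-- `L = (F₁, …, F_k)` is a face chain in `F`: all `F_i` are faces contained in `F`, and
`F₁ ≤ F₂ ≤ ⋯ ≤ F_k`. -/
def IsFaceChain (F : Set (Fin n → ℝ)) (L : List (Set (Fin n → ℝ))) : Prop :=
  (∀ G ∈ L, G ∈ P.faces ∧ G ⊆ F) ∧ L.IsChain P.FaceLE

end CellPolytope

/-- The excess of `(F₁, …, F_k)` in `F`: `(dim F - 1) - ∑ (dim F_i - 1)`. -/
def excess {n : ℕ} (F : Set (Fin n → ℝ)) (L : List (Set (Fin n → ℝ))) : ℤ :=
  ((faceDim F : ℤ) - 1) - (L.map fun G => (faceDim G : ℤ) - 1).sum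

/-- Shortness: inside every face `F`, every face chain has positive excess, except for the trivial
chain `(F)` and the sequence of length zero, which is not counted as a chain. -/
def CellPolytope.IsShort {n : ℕ} (P : CellPolytope n) : Prop :=
  ∀ F ∈ P.faces, ∀ L : List (Set (Fin n → ℝ)),
    P.IsFaceChain F L → L ≠ [] → L ≠ [F] → 0 < excess F L

/-- The product `G × I ⊆ ℝⁿ⁺¹` of `G ⊆ ℝⁿ` and `I ⊆ ℝ`, where `I` is the last coordinate. -/
def prodLast {n : ℕ} (G : Set (Fin n → ℝ)) (I : Set ℝ) : Set (Fin (n + 1) → ℝ) :=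
  {x | Fin.init x ∈ G ∧ x (Fin.last n) ∈ I}

/-- The distinguished facet `Xⁿ` of the freehedron `𝓕ⁿ`: `X¹ = {2}` and `Xⁿ = Xⁿ⁻¹ × [1, 2]` for
`n ≥ 2`. The point `𝓕⁰` has no distinguished facet. -/
def distinguishedFacet : (n : ℕ) → Set (Fin n → ℝ)
  | 0 => ∅
  | 1 => prodLast Set.univ {2}
  | n + 2 => prodLast (distinguishedFacet (n + 1)) (Set.Icc 1 2)

/-- The faces of the freehedron `𝓕ⁿ`. `𝓕⁰` is the point, and `𝓕ⁿ⁺¹` is `𝓕ⁿ × [0, 2]` with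
`Xⁿ × [0, 2]` split into `Xⁿ × [0, 1]` and `Xⁿ × [1, 2]`: for each face `G` of `𝓕ⁿ` inside `Xⁿ`
the cell `G × [0, 2]` is replaced by `G × [0, 1]`, `G × {1}` and `G × [1, 2]`. For `n = 0`
nothing is split, so that `𝓕¹` is the interval `[0, 2]`. -/
def freehedronFaces : (n : ℕ) → Set (Set (Fin n → ℝ))
  | 0 => {Set.univ}
  | n + 1 => {H | ∃ G ∈ freehedronFaces n,
      H = prodLast G {0} ∨ H = prodLast G {2} ∨
      (¬ G ⊆ distinguishedFacet n ∧ H = prodLast G (Set.Icc 0 2)) ∨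
      (G ⊆ distinguishedFacet n ∧
        (H = prodLast G (Set.Icc 0 1) ∨ H = prodLast G {1} ∨ H = prodLast G (Set.Icc 1 2)))}

/-- The freehedron `𝓕ⁿ`, a subdivision of the cube `[0, 2]ⁿ`, with its edges directed from the
coordinatewise smaller vertex to the coordinatewise larger one. -/
def freehedron (n : ℕ) : CellPolytope n where
  faces := freehedronFaces n
  dir := fun u v => u < v

end

/-!
Every face of the freehedron `𝓕ⁿ` is a box `[a, b]` spanned by two vertices, so faces are encoded by
pairs `(a, b)` (`IsCell`), and the dimension of a face is the number of coordinates in which `a` and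
`b` differ (`faceDim_Icc`).

The directed structure follows from one fact about vertices `u < v`, proved by induction on `n`:
some edge leaves `u` and ends below `v` (`exists_edge_from`), and some edge arrives at `v` and
starts above `u` (`exists_edge_to`). Hence directed paths realize the whole coordinatewise order
(`vertexLE_iff`), and within the face `[a, b]` no vertex but `a` is a source and no vertex but `b`
is a sink. A face chain is therefore a list of cells with `max Fᵢ ≤ min Fᵢ₊₁` coordinatewise.

For shortness, one adds the coordinates one at a time. The excess of a chain in `G × I` is that of
the projected chain in `G`, plus one if `I` is an interval, minus the number of members that are not
constant in the last coordinate. This can be less than the excess of the projected chain only if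
`I = [0, 2]` is split by two members into `[0, 1]` and `[1, 2]`. The projections of both members
then lie in the distinguished facet `X`, although `G` does not. So the induction carries along that
in a face not inside `X` a nontrivial chain has at least as much excess as it has members inside
`X`; for a face inside `X` no coordinate is ever split, and a chain of length `k` has excess at least `k - 1`
(`ExcessBounds`). When a coordinate is split, one unit of excess is lost, but the member that uses
`[0, 1]` is no longer inside the new distinguished facet, so the bound persists, and it was at least
`2` before (`ExcessBounds.succ`).
-/

/-! ### Cells as intervals -/

/-- `IsCell n a b` says that the box `[a, b]` is a face of the freehedron `𝓕ⁿ`. This is the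
recursion defining the faces, written in terms of the smallest vertex `a` and the largest vertex `b`
of a face; whether a face lies in the distinguished facet is read off from its smallest vertex. -/
def IsCell : (n : ℕ) → (Fin n → ℝ) → (Fin n → ℝ) → Prop
  | 0, _, _ => True
  | n + 1, a, b => IsCell n (Fin.init a) (Fin.init b) ∧
      ((a (Fin.last n) = 0 ∧ b (Fin.last n) = 0) ∨
       (a (Fin.last n) = 2 ∧ b (Fin.last n) = 2) ∨
       (Fin.init a ∉ distinguishedFacet n ∧ a (Fin.last n) = 0 ∧ b (Fin.last n) = 2) ∨
       (Fin.init a ∈ distinguishedFacet n ∧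
         ((a (Fin.last n) = 0 ∧ b (Fin.last n) = 1) ∨ (a (Fin.last n) = 1 ∧ b (Fin.last n) = 1) ∨
          (a (Fin.last n) = 1 ∧ b (Fin.last n) = 2))))

theorem mem_distinguishedFacet_succ {n : ℕ} {x : Fin (n + 1) → ℝ} :
    x ∈ distinguishedFacet (n + 1) ↔ (n = 0 ∧ x (Fin.last n) = 2) ∨
      (Fin.init x ∈ distinguishedFacet n ∧ 1 ≤ x (Fin.last n) ∧ x (Fin.last n) ≤ 2) := by
  cases n <;> simp [distinguishedFacet, prodLast]

theorem le_iff_init_last {n : ℕ} {x y : Fin (n + 1) → ℝ} :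
    x ≤ y ↔ Fin.init x ≤ Fin.init y ∧ x (Fin.last n) ≤ y (Fin.last n) := by
  simp only [Pi.le_def, Fin.forall_fin_succ', Fin.init]

theorem eq_iff_init_last {n : ℕ} {x y : Fin (n + 1) → ℝ} :
    x = y ↔ Fin.init x = Fin.init y ∧ x (Fin.last n) = y (Fin.last n) := by
  simp only [funext_iff, Fin.forall_fin_succ', Fin.init]

theorem prodLast_Icc {n : ℕ} (a b : Fin (n + 1) → ℝ) :
    prodLast (Set.Icc (Fin.init a) (Fin.init b)) (Set.Icc (a (Fin.last n)) (b (Fin.last n))) =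
      Set.Icc a b := by
  ext x
  simp only [prodLast, Set.mem_ofPred_eq, Set.mem_Icc, le_iff_init_last (x := a),
    le_iff_init_last (x := x)]
  tauto

theorem prodLast_Icc_snoc {n : ℕ} (a b : Fin n → ℝ) (s t : ℝ) :
    prodLast (Set.Icc a b) (Set.Icc s t) =
      Set.Icc (Fin.snoc a s : Fin (n + 1) → ℝ) (Fin.snoc b t : Fin (n + 1) → ℝ) := by
  simp [← prodLast_Icc]

/-- The distinguished facet is an upper set in the cube `[0, 2]ⁿ`. -/
theorem distinguishedFacet_mono : ∀ {n : ℕ} {x y : Fin n → ℝ}, x ∈ distinguishedFacet n →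
    x ≤ y → (∀ i, y i ≤ 2) → y ∈ distinguishedFacet n
  | 0, _, _, hx, _, _ => hx
  | n + 1, x, y, hx, hxy, hy => by
    rw [le_iff_init_last] at hxy
    rw [mem_distinguishedFacet_succ] at hx ⊢
    rcases hx with ⟨h0, h⟩ | ⟨h, h1, h2⟩
    · exact .inl ⟨h0, le_antisymm (hy _) (h ▸ hxy.2)⟩
    · exact .inr ⟨distinguishedFacet_mono h hxy.1 fun i => hy _, h1.trans hxy.2, hy _⟩

namespace IsCell

theorem le : ∀ {n : ℕ} {a b : Fin n → ℝ}, IsCell n a b → a ≤ b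
  | 0, _, _, _ => fun i => i.elim0
  | n + 1, a, b, h => by
    rw [le_iff_init_last]
    refine ⟨h.1.le, ?_⟩
    rcases h.2 with h | h | h | ⟨-, h | h | h⟩ <;> norm_num [h]

theorem left : ∀ {n : ℕ} {a b : Fin n → ℝ}, IsCell n a b → IsCell n a a
  | 0, _, _, _ => trivial
  | n + 1, a, b, h => by
    refine ⟨h.1.left, ?_⟩
    rcases h.2 with h | h | h | ⟨hX, h | h | h⟩ <;> simp [*]

theorem snd_mem : ∀ {n : ℕ} {a b : Fin n → ℝ}, IsCell n a b → ∀ i, b i = 0 ∨ b i = 1 ∨ b i = 2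
  | 0, _, _, _ => fun i => i.elim0
  | n + 1, a, b, h => by
    rw [Fin.forall_fin_succ']
    refine ⟨h.1.snd_mem, ?_⟩
    rcases h.2 with h | h | h | ⟨hX, h | h | h⟩ <;> simp [*]

theorem snd_le_two {n : ℕ} {a b : Fin n → ℝ} (h : IsCell n a b) (i : Fin n) : b i ≤ 2 := by
  rcases h.snd_mem i with h | h | h <;> norm_num [h]

theorem right : ∀ {n : ℕ} {a b : Fin n → ℝ}, IsCell n a b → IsCell n b b
  | 0, _, _, _ => trivial
  | n + 1, a, b, h => by
    refine ⟨h.1.right, ?_⟩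
    have hX := fun hX => distinguishedFacet_mono hX h.1.le h.1.snd_le_two
    rcases h.2 with h | h | h | ⟨hX', h | h | h⟩ <;> simp [*]

theorem Icc_subset_distinguishedFacet {n : ℕ} {a b : Fin n → ℝ} (h : IsCell n a b) :
    Set.Icc a b ⊆ distinguishedFacet n ↔ a ∈ distinguishedFacet n :=
  ⟨fun H => H ⟨le_rfl, h.le⟩,
    fun ha _ hx => distinguishedFacet_mono ha hx.1 fun i => (hx.2 i).trans (h.snd_le_two i)⟩

end IsCell

/-- The faces of the freehedron are the boxes spanned by its cells. -/
theorem mem_freehedronFaces : ∀ {n : ℕ} {H : Set (Fin n → ℝ)},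
    H ∈ freehedronFaces n ↔ ∃ a b, IsCell n a b ∧ H = Set.Icc a b
  | 0, H => by
    have : Set.Icc (default : Fin 0 → ℝ) default = Set.univ := by
      ext x; simp [Subsingleton.elim x default]
    refine ⟨fun h => ⟨default, default, trivial, h.trans this.symm⟩, ?_⟩
    rintro ⟨a, b, -, rfl⟩
    rw [Subsingleton.elim a default, Subsingleton.elim b default, this]
    rfl
  | n + 1, H => by
    constructor
    · rintro ⟨G, hG, h⟩
      obtain ⟨a, b, hab, rfl⟩ := mem_freehedronFaces.1 hG
      rw [hab.Icc_subset_distinguishedFacet] at h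
      simp only [← Set.Icc_self, prodLast_Icc_snoc] at h
      rcases h with h | h | ⟨hX, h⟩ | ⟨hX, h⟩
      · exact ⟨_, _, ⟨by simpa using hab, by simp⟩, h⟩
      · exact ⟨_, _, ⟨by simpa using hab, by simp⟩, h⟩
      · exact ⟨_, _, ⟨by simpa using hab, by simp [hX]⟩, h⟩
      · rcases h with h | h | h <;> exact ⟨_, _, ⟨by simpa using hab, by simp [hX]⟩, h⟩
    · rintro ⟨a, b, ⟨hab, h⟩, rfl⟩
      refine ⟨_, mem_freehedronFaces.2 ⟨_, _, hab, rfl⟩, ?_⟩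
      rw [hab.Icc_subset_distinguishedFacet, ← prodLast_Icc]
      rcases h with ⟨h, h'⟩ | ⟨h, h'⟩ | ⟨hX, h, h'⟩ | ⟨hX, ⟨h, h'⟩ | ⟨h, h'⟩ | ⟨h, h'⟩⟩ <;>
        simp [*]

theorem mem_vertices_freehedron {n : ℕ} {v : Fin n → ℝ} :
    v ∈ (freehedron n).vertices ↔ IsCell n v v := by
  refine mem_freehedronFaces.trans ⟨?_, fun h => ⟨v, v, h, (Set.Icc_self v).symm⟩⟩
  rintro ⟨a, b, h, hv⟩
  have ha : a ∈ ({v} : Set _) := hv ▸ ⟨le_rfl, h.le⟩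
  rw [← Set.mem_singleton_iff.1 ha]
  exact h.left

/-! ### Dimension -/

/-- The number of coordinates in which the box `[a, b]` is not degenerate. -/
noncomputable def boxDim {n : ℕ} (a b : Fin n → ℝ) : ℕ :=
  ∑ i, if a i = b i then 0 else 1

theorem boxDim_succ {n : ℕ} (a b : Fin (n + 1) → ℝ) :
    boxDim a b = boxDim (Fin.init a) (Fin.init b) +
      if a (Fin.last n) = b (Fin.last n) then 0 else 1 :=
  Fin.sum_univ_castSucc _

theorem boxDim_self {n : ℕ} (a : Fin n → ℝ) : boxDim a a = 0 := by
  simp [boxDim]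

theorem boxDim_eq_zero {n : ℕ} {a b : Fin n → ℝ} : boxDim a b = 0 ↔ a = b := by
  simp [boxDim, funext_iff]

theorem vectorSpan_Icc {n : ℕ} {a b : Fin n → ℝ} (hab : a ≤ b) :
    vectorSpan ℝ (Set.Icc a b) =
      ⨅ i ∈ {i | a i = b i}, LinearMap.ker (LinearMap.proj i : (Fin n → ℝ) →ₗ[ℝ] ℝ) := by
  apply le_antisymm
  · refine Submodule.span_le.2 ?_
    rintro _ ⟨x, hx, y, hy, rfl⟩
    simp only [Set.mem_ofPred_eq, SetLike.mem_coe, Submodule.mem_iInf, LinearMap.mem_ker,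
      LinearMap.proj_apply]
    intro i hi
    have := hx.1 i; have := hx.2 i; have := hy.1 i; have := hy.2 i
    simp only [vsub_eq_sub, Pi.sub_apply]
    linarith
  · intro v hv
    simp only [Set.mem_ofPred_eq, Submodule.mem_iInf, LinearMap.mem_ker,
      LinearMap.proj_apply] at hv
    rw [pi_eq_sum_univ' v]
    refine Submodule.sum_mem _ fun i _ => ?_
    by_cases hi : a i = b i
    · simp [hv i hi]
    -- the side of the box in direction `i` is the difference of two of its points
    have key : Function.update a i (b i) -ᵥ a ∈ vectorSpan ℝ (Set.Icc a b) := by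
      refine vsub_mem_vectorSpan ℝ ⟨?_, ?_⟩ ⟨le_rfl, hab⟩
      · exact le_update_iff.2 ⟨hab i, fun _ _ => le_rfl⟩
      · exact update_le_iff.2 ⟨le_rfl, fun j _ => hab j⟩
    convert Submodule.smul_mem _ (v i / (b i - a i)) key using 1
    have : b i - a i ≠ 0 := sub_ne_zero.2 (Ne.symm hi)
    ext j
    by_cases hj : i = j
    · subst hj; simp [this]
    · simp [Ne.symm hj]

theorem faceDim_Icc {n : ℕ} {a b : Fin n → ℝ} (hab : a ≤ b) :
    faceDim (Set.Icc a b) = boxDim a b := by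
  classical
  rw [faceDim, vectorSpan_Icc hab, LinearEquiv.finrank_eq (LinearMap.iInfKerProjEquiv ℝ
    (fun _ => ℝ) (I := {i | a i ≠ b i}) (J := {i | a i = b i}) ?_ ?_)]
  · simp [boxDim, Fintype.card_subtype, Finset.sum_ite]
  · exact Set.disjoint_left.2 fun i h h' => h h'
  · intro i _
    exact (em (a i = b i)).symm

/-! ### Edges and the order on vertices -/

/-- Above a vertex `u` and below a larger vertex `v`, some edge leaves `u`. -/
theorem exists_edge_from : ∀ {n : ℕ} {u v : Fin n → ℝ}, IsCell n u u → IsCell n v v → u ≤ v →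
    u ≠ v → ∃ w, IsCell n u w ∧ boxDim u w = 1 ∧ w ≤ v
  | 0, _, _, _, _, _, h => (h (Subsingleton.elim _ _)).elim
  | n + 1, u, v, hu, hv, huv, hne => by
    rw [le_iff_init_last] at huv
    obtain ⟨huv', huvl⟩ := huv
    have hX := fun h => distinguishedFacet_mono h huv' hv.1.snd_le_two
    by_cases h : Fin.init u = Fin.init v ∨ (u (Fin.last n) ≠ v (Fin.last n) ∧
        (Fin.init v ∈ distinguishedFacet n → Fin.init u ∈ distinguishedFacet n))
    · -- The edge is parallel to the last axis. If it runs from `0` to `2`, then the projection of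
      -- `u`, hence that of `v`, is not in the distinguished facet, so `v` does not end in `1`.
      have hl : u (Fin.last n) ≠ v (Fin.last n) := by
        rcases h with h | h
        · exact fun h' => hne (eq_iff_init_last.2 ⟨h, h'⟩)
        · exact h.1
      have hX' : Fin.init v ∈ distinguishedFacet n → Fin.init u ∈ distinguishedFacet n := by
        rcases h with h | h
        · rw [h]; exact id
        · exact h.2
      have key : ∃ t, IsCell (n + 1) u (Fin.snoc (Fin.init u) t) ∧ u (Fin.last n) ≠ t ∧
          t ≤ v (Fin.last n) := by
        have h1 := hu.2
        have h2 := hv.2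
        simp only [IsCell, Fin.init_snoc, Fin.snoc_last, hu.1, true_and]
        by_cases hXu : Fin.init u ∈ distinguishedFacet n
        · rcases h1 with h1 | h1 | h1 | h1
          · refine ⟨1, ?_⟩
            rcases h2 with h2 | h2 | h2 | ⟨hm, h2 | h2 | h2⟩ <;> grind
          all_goals
            refine ⟨2, ?_⟩
            rcases h2 with h2 | h2 | h2 | ⟨hm, h2 | h2 | h2⟩ <;> grind
        · refine ⟨2, ?_⟩
          rcases h2 with h2 | h2 | h2 | ⟨hm, h2 | h2 | h2⟩ <;> grind
      obtain ⟨t, ht, hne', hle⟩ := key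
      refine ⟨_, ht, ?_, ?_⟩
      · simp [boxDim_succ, boxDim_self, hne']
      · simpa [le_iff_init_last] using ⟨huv', hle⟩
    · -- The edge lies in a copy of the previous freehedron.
      push Not at h
      obtain ⟨w, hw, hd, hle⟩ := exists_edge_from hu.1 hv.1 huv' h.1
      refine ⟨Fin.snoc w (u (Fin.last n)), ⟨by simpa using hw, ?_⟩, ?_, ?_⟩
      · have := hu.2
        simp only [Fin.snoc_last]
        grind
      · simp [boxDim_succ, hd]
      · simpa [le_iff_init_last] using ⟨hle, huvl⟩

/-- Below a vertex `v` and above a smaller vertex `u`, some edge arrives at `v`. -/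
theorem exists_edge_to : ∀ {n : ℕ} {u v : Fin n → ℝ}, IsCell n u u → IsCell n v v → u ≤ v →
    u ≠ v → ∃ w, IsCell n w v ∧ boxDim w v = 1 ∧ u ≤ w
  | 0, _, _, _, _, _, h => (h (Subsingleton.elim _ _)).elim
  | n + 1, u, v, hu, hv, huv, hne => by
    rw [le_iff_init_last] at huv
    obtain ⟨huv', huvl⟩ := huv
    by_cases hl : u (Fin.last n) = v (Fin.last n)
    · -- The edge lies in a copy of the previous freehedron.
      obtain ⟨w, hw, hd, hle⟩ := exists_edge_to hu.1 hv.1 huv'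
        fun h => hne (eq_iff_init_last.2 ⟨h, hl⟩)
      refine ⟨Fin.snoc w (v (Fin.last n)), ⟨by simpa using hw, ?_⟩, ?_, ?_⟩
      · have := hu.2
        have := fun h => distinguishedFacet_mono h hle fun i => (hw.le i).trans (hw.snd_le_two i)
        simp only [Fin.snoc_last, Fin.init_snoc]
        grind
      · simp [boxDim_succ, hd]
      · simpa [le_iff_init_last] using ⟨hle, huvl⟩
    · -- The edge is parallel to the last axis.
      have key : ∃ t, IsCell (n + 1) (Fin.snoc (Fin.init v) t) v ∧ t ≠ v (Fin.last n) ∧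
          u (Fin.last n) ≤ t := by
        have h1 := hu.2
        have h2 := hv.2
        have hX := fun h => distinguishedFacet_mono h huv' hv.1.snd_le_two
        simp only [IsCell, Fin.init_snoc, Fin.snoc_last, hv.1, true_and]
        by_cases hXv : Fin.init v ∈ distinguishedFacet n
        · by_cases hv2 : v (Fin.last n) = 2
          · refine ⟨1, ?_⟩
            rcases h1 with h1 | h1 | h1 | ⟨hm, h1 | h1 | h1⟩ <;> grind
          · refine ⟨0, ?_⟩
            rcases h1 with h1 | h1 | h1 | ⟨hm, h1 | h1 | h1⟩ <;> grind
        · refine ⟨0, ?_⟩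
          rcases h1 with h1 | h1 | h1 | ⟨hm, h1 | h1 | h1⟩ <;> grind
      obtain ⟨t, ht, hne', hle⟩ := key
      refine ⟨_, ht, ?_, ?_⟩
      · simp [boxDim_succ, boxDim_self, hne']
      · simpa [le_iff_init_last] using ⟨huv', hle⟩

/-- An edge contains no vertices besides its two endpoints. -/
theorem eq_or_eq_of_mem_edge : ∀ {n : ℕ} {a b v : Fin n → ℝ}, IsCell n a b → boxDim a b = 1 →
    IsCell n v v → a ≤ v → v ≤ b → v = a ∨ v = b
  | 0, _, _, _, _, _, _, _, _ => .inl (Subsingleton.elim _ _)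
  | n + 1, a, b, v, h, hd, hv, hav, hvb => by
    rw [le_iff_init_last] at hav hvb
    rw [boxDim_succ] at hd
    simp only [eq_iff_init_last (x := v)]
    split_ifs at hd with hl
    · have hvl : v (Fin.last n) = a (Fin.last n) := le_antisymm (hl ▸ hvb.2) hav.2
      rw [← hl, hvl]
      simpa using eq_or_eq_of_mem_edge h.1 (by simpa using hd) hv.1 hav.1 hvb.1
    · have hab : Fin.init a = Fin.init b := boxDim_eq_zero.1 (by omega)
      have hva : Fin.init v = Fin.init a := le_antisymm (hab ▸ hvb.1) hav.1
      have h1 := h.2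
      have h2 := hv.2
      simp only [hva, ← hab, true_and] at h2 ⊢
      grind

theorem ne_of_boxDim_eq_one {n : ℕ} {a b : Fin n → ℝ} (h : boxDim a b = 1) : a ≠ b := by
  rintro rfl
  simp [boxDim_self] at h

theorem arrowIn_freehedron_lt {n : ℕ} {F : Set (Fin n → ℝ)} {u v : Fin n → ℝ}
    (h : (freehedron n).ArrowIn F u v) : u < v :=
  h.choose_spec.2.2.2.2.2.2.2.2

theorem IsCell.arrowIn {n : ℕ} {F : Set (Fin n → ℝ)} {u v : Fin n → ℝ} (h : IsCell n u v)
    (hd : boxDim u v = 1) (hF : Set.Icc u v ⊆ F) : (freehedron n).ArrowIn F u v :=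
  ⟨Set.Icc u v, mem_freehedronFaces.2 ⟨u, v, h, rfl⟩, hF, by rw [faceDim_Icc h.le, hd],
    mem_vertices_freehedron.2 h.left, mem_vertices_freehedron.2 h.right, ⟨le_rfl, h.le⟩,
    ⟨h.le, le_rfl⟩, ne_of_boxDim_eq_one hd, h.le.lt_of_ne (ne_of_boxDim_eq_one hd)⟩

theorem finite_setOf_isCell_self (n : ℕ) : {v | IsCell n v v}.Finite := by
  refine (Set.Finite.pi' fun _ : Fin n => Set.toFinite {(0 : ℝ), 1, 2}).subset ?_
  exact fun v hv i => hv.snd_mem i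

/-- Directed edge paths induce the coordinatewise order: from `u` one climbs to a larger vertex `v`
along edges that stay below `v`. -/
theorem vertexLE_iff {n : ℕ} {u v : Fin n → ℝ} (hu : IsCell n u u) (hv : IsCell n v v) :
    (freehedron n).VertexLE u v ↔ u ≤ v := by
  constructor
  · intro h
    induction h with
    | refl => exact le_rfl
    | tail _ hbc ih =>
      obtain ⟨-, -, -, -, hb, -⟩ := id hbc
      exact (ih (mem_vertices_freehedron.1 hb)).trans (arrowIn_freehedron_lt hbc).le
  · intro huv
    refine (finite_setOf_isCell_self n).wellFoundedOn (r := (· > ·)) |>.induction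
      (P := fun u => u ≤ v → (freehedron n).VertexLE u v) hu ?_ huv
    intro u hu ih huv
    by_cases hne : u = v
    · exact hne ▸ .refl
    obtain ⟨w, hw, hd, hle⟩ := exists_edge_from hu hv huv hne
    exact .head (hw.arrowIn hd (Set.subset_univ _))
      (ih w hw.right (hw.le.lt_of_ne (ne_of_boxDim_eq_one hd)) hle)

theorem isSource_Icc_iff {n : ℕ} {a b v : Fin n → ℝ} (h : IsCell n a b) :
    (freehedron n).IsSource (Set.Icc a b) v ↔ v = a := by
  constructor
  · rintro ⟨hv, hmem, hno⟩
    by_contra hne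
    rw [mem_vertices_freehedron] at hv
    obtain ⟨w, hw, hd, hle⟩ := exists_edge_to h.left hv hmem.1 (Ne.symm hne)
    exact hno w (hw.arrowIn hd (Set.Icc_subset_Icc hle hmem.2))
  · rintro rfl
    refine ⟨mem_vertices_freehedron.2 h.left, ⟨le_rfl, h.le⟩, fun u hu => ?_⟩
    obtain ⟨e, -, he, -, -, -, hue, -⟩ := id hu
    exact (arrowIn_freehedron_lt hu).not_ge (he hue).1

theorem isSink_Icc_iff {n : ℕ} {a b v : Fin n → ℝ} (h : IsCell n a b) :
    (freehedron n).IsSink (Set.Icc a b) v ↔ v = b := by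
  constructor
  · rintro ⟨hv, hmem, hno⟩
    by_contra hne
    rw [mem_vertices_freehedron] at hv
    obtain ⟨w, hw, hd, hle⟩ := exists_edge_from hv h.right hmem.2 hne
    exact hno w (hw.arrowIn hd (Set.Icc_subset_Icc hmem.1 hle))
  · rintro rfl
    refine ⟨mem_vertices_freehedron.2 h.right, ⟨h.le, le_rfl⟩, fun u hu => ?_⟩
    obtain ⟨e, -, he, -, -, -, -, hue, -⟩ := id hu
    exact (arrowIn_freehedron_lt hu).not_ge (he hue).2

theorem faceLE_Icc_iff {n : ℕ} {a b c d : Fin n → ℝ} (h : IsCell n a b) (h' : IsCell n c d) :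
    (freehedron n).FaceLE (Set.Icc a b) (Set.Icc c d) ↔ b ≤ c := by
  simp only [CellPolytope.FaceLE, isSink_Icc_iff h, isSource_Icc_iff h']
  simp [vertexLE_iff h.right h'.left]

theorem freehedron_isDirected (n : ℕ) : (freehedron n).IsDirected := by
  constructor
  · intro e he hd
    obtain ⟨a, b, h, rfl⟩ := mem_freehedronFaces.1 he
    rw [faceDim_Icc h.le] at hd
    have hne := ne_of_boxDim_eq_one hd
    refine ⟨a, b, hne, ?_, h.le.lt_of_ne hne, (h.le.lt_of_ne hne).not_gt⟩
    ext v
    rw [Set.mem_ofPred_eq, mem_vertices_freehedron]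
    constructor
    · exact fun hv => eq_or_eq_of_mem_edge h hd hv.1 hv.2.1 hv.2.2
    · rintro (rfl | rfl)
      · exact ⟨h.left, le_rfl, h.le⟩
      · exact ⟨h.right, h.le, le_rfl⟩
  · intro F hF
    obtain ⟨a, b, h, rfl⟩ := mem_freehedronFaces.1 hF
    refine ⟨fun v hv => ?_, ?_, ?_⟩
    · have : Relation.TransGen (· < ·) v v := 
        Relation.TransGen.mono (fun _ _ h => arrowIn_freehedron_lt h) _ _ hv
      rw [Relation.transGen_eq_self] at this
      exact this.false
    · simp only [isSource_Icc_iff h, existsUnique_eq]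
    · simp only [isSink_Icc_iff h, existsUnique_eq]

/-! ### Excess of face chains -/

/-- The excess in `[a, b]` of the sequence `L` of boxes `[p.1, p.2]`. -/
noncomputable def boxExcess {n : ℕ} (a b : Fin n → ℝ) (L : List ((Fin n → ℝ) × (Fin n → ℝ))) : ℤ :=
  ((boxDim a b : ℤ) - 1) - (L.map fun p => (boxDim p.1 p.2 : ℤ) - 1).sum

/-- The projection of a box that forgets the last coordinate. -/
def initBox {n : ℕ} (p : (Fin (n + 1) → ℝ) × (Fin (n + 1) → ℝ)) : (Fin n → ℝ) × (Fin n → ℝ) :=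
  (Fin.init p.1, Fin.init p.2)

theorem boxExcess_succ {n : ℕ} (a b : Fin (n + 1) → ℝ)
    (L : List ((Fin (n + 1) → ℝ) × (Fin (n + 1) → ℝ))) :
    boxExcess a b L = boxExcess (Fin.init a) (Fin.init b) (L.map initBox) +
      (if a (Fin.last n) = b (Fin.last n) then 0 else 1) -
      (L.map fun p => if p.1 (Fin.last n) = p.2 (Fin.last n) then (0 : ℤ) else 1).sum := by
  have : (L.map fun p => (boxDim p.1 p.2 : ℤ) - 1).sum =
      (L.map fun p => (boxDim (Fin.init p.1) (Fin.init p.2) : ℤ) - 1).sum +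
      (L.map fun p => if p.1 (Fin.last n) = p.2 (Fin.last n) then (0 : ℤ) else 1).sum := by
    rw [← List.sum_map_add]
    congr 1
    refine List.map_congr_left fun p _ => ?_
    rw [boxDim_succ]
    push_cast
    ring
  rw [boxExcess, this, boxExcess, boxDim_succ, List.map_map]
  push_cast
  simp only [Function.comp_def, initBox]
  ring

/-- If a property excludes itself at later positions, at most one member of the list has it. -/
theorem sum_ite_le_one {α : Type*} {P : α → Prop} [DecidablePred P] : ∀ {L : List α},
    L.Pairwise (fun p q => P p → ¬ P q) → (L.map fun p => if P p then (1 : ℤ) else 0).sum ≤ 1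
  | [], _ => by simp
  | p :: L, h => by
    rw [List.pairwise_cons] at h
    rw [List.map_cons, List.sum_cons]
    by_cases hp : P p
    · rw [List.map_congr_left (g := fun _ => 0) fun q hq => if_neg (h.1 q hq hp)]
      simp [hp]
    · simpa [hp] using sum_ite_le_one h.2

/-- The chains of cells inside the box `[a, b]`, each cell ending below the start of all
later ones. -/
structure IsCellChain {n : ℕ} (a b : Fin n → ℝ) (L : List ((Fin n → ℝ) × (Fin n → ℝ))) : Prop where
  isCell : ∀ p ∈ L, IsCell n p.1 p.2
  le_fst : ∀ p ∈ L, a ≤ p.1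
  snd_le : ∀ p ∈ L, p.2 ≤ b
  pairwise : L.Pairwise fun p q => p.2 ≤ q.1

theorem IsCellChain.init {n : ℕ} {a b : Fin (n + 1) → ℝ}
    {L : List ((Fin (n + 1) → ℝ) × (Fin (n + 1) → ℝ))} (h : IsCellChain a b L) :
    IsCellChain (Fin.init a) (Fin.init b) (L.map initBox) where
  isCell := List.forall_mem_map.2 fun p hp => (h.isCell p hp).1
  le_fst := List.forall_mem_map.2 fun p hp => (le_iff_init_last.1 (h.le_fst p hp)).1
  snd_le := List.forall_mem_map.2 fun p hp => (le_iff_init_last.1 (h.snd_le p hp)).1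
  pairwise := List.pairwise_map.2 (h.pairwise.imp fun h => (le_iff_init_last.1 h).1)

open scoped Classical in
/-- The number of members of `L` that lie in the distinguished facet. -/
noncomputable def facetCount {n : ℕ} (L : List ((Fin n → ℝ) × (Fin n → ℝ))) : ℤ :=
  (L.map fun p => if p.1 ∈ distinguishedFacet n then 1 else 0).sum

/-- The three lower bounds for the excess of a chain `L` in the box `[a, b]` that are proved
together: one for boxes in the distinguished facet, where no coordinate is split, one for all other
boxes, and shortness. The second bound pays for the one unit of excess which is lost when the next
coordinate is split between two members of the chain, both of them in the distinguished facet.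
The point `𝓕⁰` satisfies the first bound, although it has no distinguished facet. -/
structure ExcessBounds {n : ℕ} (a b : Fin n → ℝ) (L : List ((Fin n → ℝ) × (Fin n → ℝ))) : Prop where
  of_mem : n = 0 ∨ a ∈ distinguishedFacet n → (L.length : ℤ) - 1 ≤ boxExcess a b L
  of_notMem : a ∉ distinguishedFacet n → L ≠ [(a, b)] → facetCount L ≤ boxExcess a b L
  pos : L ≠ [(a, b)] → 1 ≤ boxExcess a b L

/-- The bounds for a single cell whose projection is the whole projected box. -/
theorem excessBounds_singleton {n : ℕ} {a b : Fin (n + 1) → ℝ} (hab : IsCell (n + 1) a b)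
    {p : (Fin (n + 1) → ℝ) × (Fin (n + 1) → ℝ)} (h : IsCellChain a b [p])
    (hp : initBox p = (Fin.init a, Fin.init b)) : ExcessBounds a b [p] := by
  have hc := (h.isCell p (by simp)).2
  have h1 := (le_iff_init_last.1 (h.le_fst p (by simp))).2
  have h2 := (le_iff_init_last.1 (h.snd_le p (by simp))).2
  have hE : boxExcess a b [p] = (if a (Fin.last n) = b (Fin.last n) then 0 else 1) -
      if p.1 (Fin.last n) = p.2 (Fin.last n) then 0 else 1 := by
    rw [boxExcess_succ, List.map_singleton, hp]
    simp [boxExcess]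
  obtain ⟨hp1, hp2⟩ := Prod.ext_iff.1 hp
  simp only [initBox] at hp1 hp2
  have hne : [p] ≠ [(a, b)] → ¬ (p.1 (Fin.last n) = a (Fin.last n) ∧
      p.2 (Fin.last n) = b (Fin.last n)) := fun h ⟨h1, h2⟩ => h (by
    rw [List.cons_eq_cons]
    exact ⟨Prod.ext (eq_iff_init_last.2 ⟨hp1, h1⟩) (eq_iff_init_last.2 ⟨hp2, h2⟩), rfl⟩)
  have hl := hab.2
  rw [hp1] at hc
  have hpos : [p] ≠ [(a, b)] → 1 ≤ boxExcess a b [p] := fun h => by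
    have := hne h
    rw [hE]
    clear hne hE h hp hp1 hp2
    grind
  refine ⟨fun _ => ?_, fun _ h => le_trans ?_ (hpos h), hpos⟩
  · by_cases h : [p] = [(a, b)]
    · obtain rfl : p = (a, b) := by simpa using h
      simp [hE]
    · have := hpos h
      simp only [List.length_singleton]
      omega
  · simp only [facetCount, List.map_singleton, List.sum_singleton]
    split_ifs <;> norm_num

set_option maxHeartbeats 800000 in
/-- The inductive step: the last coordinate is attached to a chain whose projection is not trivial.
-/
theorem ExcessBounds.succ {n : ℕ} {a b : Fin (n + 1) → ℝ} (hab : IsCell (n + 1) a b)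
    {L : List ((Fin (n + 1) → ℝ) × (Fin (n + 1) → ℝ))} (h : IsCellChain a b L)
    (hL : L.map initBox ≠ [(Fin.init a, Fin.init b)])
    (ih : ExcessBounds (Fin.init a) (Fin.init b) (L.map initBox)) : ExcessBounds a b L := by
  classical
  have hE := boxExcess_succ a b L
  have hpos := ih.pos hL
  have hmem := ih.of_mem
  have hnot := fun h => ih.of_notMem h hL
  rw [List.length_map] at hmem
  set E := boxExcess (Fin.init a) (Fin.init b) (L.map initBox)
  have hc : facetCount (L.map initBox) =
      (L.map fun p => if (Fin.init p.1 : Fin n → ℝ) ∈ distinguishedFacet n then 1 else 0).sum := by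
    rw [facetCount, List.map_map]; rfl
  rw [hc] at hnot
  have hlen : (L.length : ℤ) = (L.map fun _ => (1 : ℤ)).sum := by simp
  rw [hlen] at hmem
  -- At most one member starts at the bottom `0` of the last coordinate and leaves it, and at most
  -- one arrives at its top `2`.
  have hA : (L.map fun p => if p.1 (Fin.last n) = 0 ∧ p.2 (Fin.last n) ≠ 0
      then (1 : ℤ) else 0).sum ≤ 1 := by
    refine sum_ite_le_one (h.pairwise.imp_of_mem ?_)
    rintro p q hp hq hpq ⟨hp1, hp2⟩ ⟨hq1, -⟩
    exact hp2 (le_antisymm (hq1 ▸ hpq _) (hp1 ▸ (h.isCell p hp).le _))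
  have hB : (L.map fun p => if p.2 (Fin.last n) = 2 ∧ p.1 (Fin.last n) ≠ 2
      then (1 : ℤ) else 0).sum ≤ 1 := by
    refine sum_ite_le_one (h.pairwise.imp_of_mem ?_)
    rintro p q hp hq hpq ⟨hp1, -⟩ ⟨hq1, hq2⟩
    exact hq2 (le_antisymm (hq1 ▸ (h.isCell q hq).le _) (hp1 ▸ hpq _))
  have hcell : ∀ p ∈ L, _ := fun p hp => (h.isCell p hp).2
  have hX : ∀ p ∈ L, (p.1 ∈ distinguishedFacet (n + 1) ↔ _) :=
    fun p _ => mem_distinguishedFacet_succ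
  have hXa := mem_distinguishedFacet_succ (x := a)
  have h1 : ∀ p ∈ L, a (Fin.last n) ≤ p.1 (Fin.last n) := fun p hp => h.le_fst p hp _
  have h2 : ∀ p ∈ L, p.2 (Fin.last n) ≤ b (Fin.last n) := fun p hp => h.snd_le p hp _
  have hup : ∀ p ∈ L, Fin.init a ∈ distinguishedFacet n → Fin.init p.1 ∈ distinguishedFacet n :=
    fun p hp ha => distinguishedFacet_mono ha (le_iff_init_last.1 (h.le_fst p hp)).1
      (h.isCell p hp).1.left.snd_le_two
  have hn0 : n = 0 → ∀ x : Fin n → ℝ, x ∉ distinguishedFacet n := by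
    rintro rfl x hx
    exact hx
  have hab2 := hab.2
  by_cases hl : a (Fin.last n) = b (Fin.last n)
  · -- The last coordinate of the box is constant, hence that of all members.
    have ht : (L.map fun p => if p.1 (Fin.last n) = p.2 (Fin.last n) then (0 : ℤ) else 1).sum =
        (L.map fun _ => (0 : ℤ)).sum := by
      congr 1
      refine List.map_congr_left fun p hp => if_pos (le_antisymm ((h.isCell p hp).le _) ?_)
      exact ((h2 p hp).trans_eq hl.symm).trans (h1 p hp)
    rw [ht, if_pos hl] at hE
    simp only [List.map_const', List.sum_replicate, smul_zero, add_zero, sub_zero] at hE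
    refine ⟨fun ha => ?_, fun ha _ => ?_, fun _ => hE ▸ hpos⟩
    · rw [hE, hlen]
      apply hmem
      rw [hXa] at ha
      tauto
    · rw [hE]
      by_cases ha0 : Fin.init a ∈ distinguishedFacet n
      · -- The box lies in the bottom, which is disjoint from the distinguished facet.
        refine le_trans ?_ (zero_le_one.trans hpos)
        have : facetCount L ≤ (L.map fun _ => (0 : ℤ)).sum := by
          refine List.sum_le_sum fun p hp => ?_
          have := hX p hp
          have := h1 p hp
          have := h2 p hp
          have := hcell p hp
          grind
        simpa using this
      · refine le_trans (List.sum_le_sum fun p hp => ?_) (hnot ha0)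
        have := hX p hp
        have := h1 p hp
        have := h2 p hp
        have := hcell p hp
        grind
  rw [if_neg hl] at hE
  by_cases ha0 : Fin.init a ∈ distinguishedFacet n
  · -- The last coordinate of the box is `[0, 1]` or `[1, 2]`, and is not split.
    have ht : (L.map fun p => if p.1 (Fin.last n) = p.2 (Fin.last n) then (0 : ℤ) else 1).sum ≤
        1 := by
      by_cases hb : b (Fin.last n) = 1
      · refine le_trans (List.sum_le_sum fun p hp => ?_) hA
        have := h1 p hp
        have := h2 p hp
        have := hcell p hp
        grind
      · refine le_trans (List.sum_le_sum fun p hp => ?_) hB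
        have := h1 p hp
        have := h2 p hp
        have := hcell p hp
        grind
    have hk := hmem (.inr ha0)
    refine ⟨fun _ => by omega, fun ha _ => ?_, fun _ => by omega⟩
    -- A member in the distinguished facet is constant in the last coordinate.
    have : facetCount L +
        (L.map fun p => if p.1 (Fin.last n) = p.2 (Fin.last n) then (0 : ℤ) else 1).sum ≤
        (L.map fun _ => (1 : ℤ)).sum := by
      rw [facetCount, ← List.sum_map_add]
      refine List.sum_le_sum fun p hp => ?_
      have := hX p hp
      have := h1 p hp
      have := h2 p hp
      have := hcell p hp
      grind
    omega
  · -- The last coordinate of the box is `[0, 2]`.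
    have hbox : a (Fin.last n) = 0 ∧ b (Fin.last n) = 2 := by grind
    have ha : ¬ (n + 1 = 0 ∨ a ∈ distinguishedFacet (n + 1)) := by grind
    by_cases hn : n = 0
    · have ht : (L.map fun p => if p.1 (Fin.last n) = p.2 (Fin.last n) then (0 : ℤ) else 1).sum ≤
          1 := by
        refine le_trans (List.sum_le_sum fun p hp => ?_) hA
        have := hn0 hn (Fin.init p.1)
        have := hcell p hp
        grind
      have hk := hmem (.inl hn)
      refine ⟨fun h => (ha h).elim, fun _ _ => ?_, fun _ => by omega⟩
      have : facetCount L +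
          (L.map fun p => if p.1 (Fin.last n) = p.2 (Fin.last n) then (0 : ℤ) else 1).sum ≤
          (L.map fun _ => (1 : ℤ)).sum := by
        rw [facetCount, ← List.sum_map_add]
        refine List.sum_le_sum fun p hp => ?_
        have := hn0 hn (Fin.init p.1)
        have := hX p hp
        have := hcell p hp
        grind
      omega
    · have hc0 := hnot ha0
      have hle : facetCount L ≤
          (L.map fun p =>
            if (Fin.init p.1 : Fin n → ℝ) ∈ distinguishedFacet n then (1 : ℤ) else 0).sum := by
        refine List.sum_le_sum fun p hp => ?_
        have := hX p hp
        grind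
      by_cases ht : (L.map fun p =>
          if p.1 (Fin.last n) = p.2 (Fin.last n) then (0 : ℤ) else 1).sum ≤ 1
      · exact ⟨fun h => (ha h).elim, fun _ _ => by omega, fun _ => by omega⟩
      -- The last coordinate is split into `[0, 1]` and `[1, 2]` by two members. Their projections
      -- lie in the distinguished facet (`hc2`), but the member that uses `[0, 1]` does not (`hc1`).
      -- Members that use `[0, 2]` are counted both in `hA` and in `hB`.
      have hAB : (L.map fun p => if p.1 (Fin.last n) = p.2 (Fin.last n) then (0 : ℤ) else 1).sum +
          (L.map fun p => if p.1 (Fin.last n) = 0 ∧ p.2 (Fin.last n) = 2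
            then (1 : ℤ) else 0).sum =
          (L.map fun p => if p.1 (Fin.last n) = 0 ∧ p.2 (Fin.last n) ≠ 0
            then (1 : ℤ) else 0).sum +
          (L.map fun p => if p.2 (Fin.last n) = 2 ∧ p.1 (Fin.last n) ≠ 2
            then (1 : ℤ) else 0).sum := by
        rw [← List.sum_map_add, ← List.sum_map_add]
        congr 1
        refine List.map_congr_left fun p hp => ?_
        have := hcell p hp
        grind
      have h02 : 0 ≤ (L.map fun p => if p.1 (Fin.last n) = 0 ∧ p.2 (Fin.last n) = 2
            then (1 : ℤ) else 0).sum := by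
        refine List.sum_nonneg (List.forall_mem_map.2 fun p hp => ?_)
        split_ifs <;> norm_num
      have hc1 : facetCount L +
          (L.map fun p => if p.1 (Fin.last n) = 0 ∧ p.2 (Fin.last n) ≠ 0
            then (1 : ℤ) else 0).sum ≤
          (L.map fun p =>
            if (Fin.init p.1 : Fin n → ℝ) ∈ distinguishedFacet n then (1 : ℤ) else 0).sum +
          (L.map fun p => if p.1 (Fin.last n) = 0 ∧ p.2 (Fin.last n) = 2
            then (1 : ℤ) else 0).sum := by
        rw [facetCount, ← List.sum_map_add, ← List.sum_map_add]
        refine List.sum_le_sum fun p hp => ?_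
        have := hX p hp
        have := hcell p hp
        grind
      have hc2 : (L.map fun p =>
          if p.1 (Fin.last n) = p.2 (Fin.last n) then (0 : ℤ) else 1).sum ≤
          (L.map fun p =>
            if (Fin.init p.1 : Fin n → ℝ) ∈ distinguishedFacet n then (1 : ℤ) else 0).sum +
          (L.map fun p => if p.1 (Fin.last n) = 0 ∧ p.2 (Fin.last n) = 2
            then (1 : ℤ) else 0).sum := by
        rw [← List.sum_map_add]
        refine List.sum_le_sum fun p hp => ?_
        have := hcell p hp
        grind
      exact ⟨fun h => (ha h).elim, fun _ _ => by omega, fun _ => by omega⟩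

/-- Every chain of cells satisfies the bounds. -/
theorem IsCellChain.excessBounds : ∀ {n : ℕ} {a b : Fin n → ℝ}
    {L : List ((Fin n → ℝ) × (Fin n → ℝ))}, IsCell n a b → IsCellChain a b L → L ≠ [] →
    ExcessBounds a b L
  | 0, a, b, L, hab, h, hL => by
    have hE : boxExcess a b L = L.length - 1 := by
      simp [boxExcess, boxDim]
      ring
    have hpos : L ≠ [(a, b)] → 1 ≤ boxExcess a b L := fun hne => by
      match L, hL, hne with
      | [p], _, hne => exact (hne (by rw [Subsingleton.elim p (a, b)])).elim
      | p :: q :: L, _, _ => rw [hE]; simp only [List.length_cons]; omega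
    refine ⟨fun _ => hE.ge, fun _ h => ?_, hpos⟩
    have := hpos h
    have hc : facetCount L = 0 := by simp [facetCount, distinguishedFacet]
    omega
  | n + 1, a, b, L, hab, h, hL => by
    by_cases hL' : L.map initBox = [(Fin.init a, Fin.init b)]
    · obtain ⟨p, rfl, hp⟩ := List.map_eq_singleton_iff.1 hL'
      exact excessBounds_singleton hab h hp
    · exact .succ hab h hL' (h.init.excessBounds hab.1 (by simpa using hL))

theorem excess_map_Icc {n : ℕ} {a b : Fin n → ℝ} (hab : a ≤ b)
    {L : List ((Fin n → ℝ) × (Fin n → ℝ))} (hL : ∀ p ∈ L, p.1 ≤ p.2) :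
    excess (Set.Icc a b) (L.map fun p => Set.Icc p.1 p.2) = boxExcess a b L := by
  rw [excess, boxExcess, faceDim_Icc hab, List.map_map]
  congr 2
  refine List.map_congr_left fun p hp => ?_
  simp [faceDim_Icc (hL p hp)]

theorem freehedron_isShort (n : ℕ) : (freehedron n).IsShort := by
  intro F hF L hL hne hne'
  obtain ⟨a, b, hab, rfl⟩ := mem_freehedronFaces.1 hF
  obtain ⟨M, hM, rfl⟩ : ∃ M : List ((Fin n → ℝ) × (Fin n → ℝ)),
      (∀ p ∈ M, IsCell n p.1 p.2) ∧ M.map (fun p => Set.Icc p.1 p.2) = L := by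
    have h : ∀ G ∈ L, ∃ p : (Fin n → ℝ) × (Fin n → ℝ), IsCell n p.1 p.2 ∧ Set.Icc p.1 p.2 = G := by
      intro G hG
      obtain ⟨c, d, h, rfl⟩ := mem_freehedronFaces.1 (hL.1 G hG).1
      exact ⟨(c, d), h, rfl⟩
    clear hL hne hne'
    induction L with
    | nil => exact ⟨[], by simp⟩
    | cons G L ih =>
      obtain ⟨p, hp, rfl⟩ := h G (by simp)
      obtain ⟨M, hM, rfl⟩ := ih fun G hG => h G (by simp [hG])
      exact ⟨p :: M, by simpa using ⟨hp, fun a b => hM (a, b)⟩, rfl⟩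
  have hsub : ∀ p ∈ M, a ≤ p.1 ∧ p.2 ≤ b := fun p hp =>
    (Set.Icc_subset_Icc_iff (hM p hp).le).1 (hL.1 _ (List.mem_map_of_mem hp)).2
  have hpw : M.Pairwise fun p q => p.2 ≤ q.1 := by
    have hc := List.isChain_map _ |>.1 hL.2
    have htrans : IsTrans ((Fin n → ℝ) × (Fin n → ℝ)) fun p q => p.2 ≤ q.1 ∧ q.1 ≤ q.2 :=
      ⟨fun p q r h h' => ⟨h.1.trans (h.2.trans h'.1), h'.2⟩⟩
    refine (List.IsChain.pairwise (R := fun p q : (Fin n → ℝ) × (Fin n → ℝ) =>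
      p.2 ≤ q.1 ∧ q.1 ≤ q.2) ?_).imp And.left
    exact hc.imp_of_mem_imp fun p q hp hq h =>
      ⟨(faceLE_Icc_iff (hM p hp) (hM q hq)).1 h, (hM q hq).le⟩
  rw [excess_map_Icc hab.le fun p hp => (hM p hp).le]
  have hchain : IsCellChain a b M := ⟨hM, fun p hp => (hsub p hp).1, fun p hp => (hsub p hp).2, hpw⟩
  refine (hchain.excessBounds hab (by simpa using hne)).pos ?_
  rintro rfl
  exact hne' rfl

theorem mainTheorem1 (n : ℕ) :
    (freehedron n).IsDirected ∧
    (∀ u ∈ (freehedron n).vertices, ∀ v ∈ (freehedron n).vertices,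
      (freehedron n).VertexLE u v ↔ u ≤ v) ∧
    (freehedron n).IsShort :=
  ⟨freehedron_isDirected n, fun _ hu _ hv => vertexLE_iff (mem_vertices_freehedron.1 hu)
    (mem_vertices_freehedron.1 hv), freehedron_isShort n⟩
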